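/- \textbf{Theorem.} Let $A\in\mathbb{R}^{n\times d}$, $b\in\mathbb{R}^n$, and let $A_c=[A,b]\in\mathbb{R}^{n\times(d+1)}$ have full column rank. Let $\varepsilon>0$ and $\delta>0$, put $\beta:=\ln(4/\delta)$, and assume $\beta>1+\ln 4$ (i.e. $\delta<1/e$). Let $\sigma_0:=\sigma_{\min}(A_c)/\sqrt n$, where $\sigma_{\min}$ is the smallest nonzero singular value, and $B_0:=\max_{i,j}|(A_c)_{ij}|$. Let $q\ge 1$ and let $S_1,\dots,S_q\in\mathbb{R}^{m\times n}$ be independent Gaussian sketches, i.e. random matrices with i.i.d. $\mathcal N(0,v)$ entries, for an arbitrary variance $v>0$. Two matrices are neighboring if they differ in at most one row. A randomized algorithm $\mathrm{ALG}$ is $(\varepsilon,\delta)$-differentially private on a set $\mathcal D$ of inputs if $P(\mathrm{ALG}(X)\in T)\le e^{\varepsilon}P(\mathrm{ALG}(Y)\in T)+\delta$ for all neighboring $X,Y\in\mathcal D$ and all measurable sets $T$ of outputs. Let $\mathcal D(A_c)$ be the set of all $X\in\mathbb{R}^{n\times(d+1)}$ that are neighboring to $A_c$ (in particular $A_c$ itself)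 and have $\max_{i,j}|X_{ij}|\le B_0$. There is an absolute constant $c>0$, independent of all the quantities above, such that, whenever $$\frac{n}{d+1}\ \ge\ \Big(3+\frac{2\beta}{\varepsilon}\Big)\frac{B_0^2}{\sigma_0^2},$$ the following hold for every integer $m>d+1$. (i) (Privacy with respect to one worker.) If $$m\ \le\ c\,\Big(\frac{\sigma_0}{B_0}\Big)^4\,\beta\,\frac{n^2}{(d+1)^2}\,\frac{\varepsilon^2}{(\varepsilon+\beta)^2},$$ then publishing a single sketch, $X\mapsto S_kX$, is $(\varepsilon,\delta)$-differentially private on $\mathcal D(A_c)$. (ii) (Privacy with respect to all $q$ workers.) If $$m\ \le\ c\,\Big(\frac{\sigma_0}{B_0}\Big)^4\,\frac{\beta}{q}\,\frac{n^2}{(d+1)^2}\,\frac{\varepsilon^2}{(\varepsilon+\beta)^2},$$ then publishing all sketches jointly, $X\mapsto(S_1X,\dots,S_qX)$, is $(\varepsilon,\delta)$-differentially private on $\mathcal D(A_c)$. Thus, with $\sigma_0$ and $B_0$ regarded as constants, the admissible sketch sizes are of order $\beta\frac{n^2}{(d+1)^2}\frac{\varepsilon^2}{(\varepsilon+\beta)^2}$,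 respectively that size divided by $q$. -/

import Mathlib

open MeasureTheory ProbabilityTheory
open scoped NNReal ENNReal Matrix

noncomputable section

/-- Real matrices carry the product (equivalently, Borel) sigma-algebra of their entries. -/
instance instMeasurableSpaceRealMatrix {ι κ : Type*} : MeasurableSpace (Matrix ι κ ℝ) :=
  inferInstanceAs (MeasurableSpace (ι → κ → ℝ))

/-- The concatenation `A_c = [A, b]`, an `n × (d + 1)` matrix whose last column is `b`. -/
def concatData {n d : ℕ} (A : Matrix (Fin n) (Fin d) ℝ) (b : Fin n → ℝ) :
    Matrix (Fin n) (Fin d ⊕ Unit) ℝ :=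
  Matrix.fromCols A (Matrix.replicateCol Unit b)

/-- `max_{i,j} |M i j|`. -/
def maxAbsEntry {ι κ : Type*} (M : Matrix ι κ ℝ) : ℝ :=
  ⨆ p : ι × κ, |M p.1 p.2|

/-- The smallest nonzero singular value. -/
def sigmaMin {ι κ : Type*} [Fintype ι] [Fintype κ] [DecidableEq κ]
    (M : Matrix ι κ ℝ) : ℝ :=
  sInf (Set.range (Matrix.toEuclideanLin M).singularValues \ {0})

/-- The law of an `m × n` Gaussian sketching matrix: i.i.d. `N(0, v)` entries, `v` the variance. -/
def gaussianSketch (m n : ℕ) (v : ℝ≥0) : Measure (Matrix (Fin m) (Fin n) ℝ) :=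
  Measure.pi fun _ : Fin m => Measure.pi fun _ : Fin n => gaussianReal 0 v

/-- The law of the sketched data `S X`, `S` a Gaussian sketch
(what is published to one worker). -/
def publishOne {n : ℕ} {κ : Type*} (m : ℕ) (v : ℝ≥0) (X : Matrix (Fin n) κ ℝ) :
    Measure (Matrix (Fin m) κ ℝ) :=
  (gaussianSketch m n v).map fun S => S * X

/-- The joint law of `(S₁ X, …, S_q X)` with independent Gaussian sketches `S₁, …, S_q`
(what is published to all `q` workers). -/
def publishAll {n : ℕ} {κ : Type*} (q m : ℕ) (v : ℝ≥0) (X : Matrix (Fin n) κ ℝ) :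
    Measure (Fin q → Matrix (Fin m) κ ℝ) :=
  (Measure.pi fun _ : Fin q => gaussianSketch m n v).map fun S k => S k * X

/-- `X` and `Y` differ in at most one row. -/
def Neighboring {ι κ : Type*} (X Y : Matrix ι κ ℝ) : Prop :=
  ∃ i, ∀ k, k ≠ i → X k = Y k

/-- A randomized algorithm, given by the law `alg X` of its output on each input `X`,
is `(ε, δ)`-differentially private on the set `D` of admissible inputs. -/
def IsDifferentiallyPrivateOn {ι κ R : Type*} [MeasurableSpace R]
    (alg : Matrix ι κ ℝ → Measure R) (D : Set (Matrix ι κ ℝ)) (ε δ : ℝ) : Prop :=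
  ∀ X ∈ D, ∀ Y ∈ D, Neighboring X Y → ∀ T : Set R, MeasurableSet T →
    alg X T ≤ ENNReal.ofReal (Real.exp ε) * alg Y T + ENNReal.ofReal δ

/-- The admissible inputs around a dataset `M`: all matrices obtained from `M` by changing
at most one row, with no entry exceeding the largest entry of `M` in absolute value. -/
def inputsAround {ι κ : Type*} (M : Matrix ι κ ℝ) : Set (Matrix ι κ ℝ) :=
  {X | Neighboring M X ∧ maxAbsEntry X ≤ maxAbsEntry M}

end

/-!
A row of `S * X`, for `S` a Gaussian sketch, is a centred Gaussian vector whose law depends on `X`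
only through the Gram matrix `Xᵀ * X` (`sketchRowLaw_congr`). If `X` and `Y` differ in row `i`, then
their Gram matrices are `G + x xᵀ` and `G + y yᵀ`, where `x`, `y` are the differing rows and `G` is
the Gram matrix of the common rows. Both matrices differ from `A_c` in at most one row, so
`G ≥ lam := σ_min² - 2 ρ`, where `ρ := (d + 1) B₀²` bounds the squared norm of every row
(`sq_sigmaMin_mul_le`, `gram_updateRow_zero_ge`).

A simultaneous diagonalization of the two Gram matrices reduces the comparison of the two row laws
to a comparison of product Gaussians with variance ratios `D j`. With `r := ρ / lam`, the ratios
satisfy `∑ j, (D j - 1)² ≤ 2 r²`, a bound free of the dimension because the perturbations have rank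
one (`exists_diagonalization_of_rank_one_perturbations`). The `s`-th moment of the likelihood ratio
of two centred Gaussians on the line is explicit, and its logarithm is at most
`(D - 1)² (s + 2 s²)` (`likelihoodMomentLE_gaussianReal`).

Log-moments add over independent components (`LikelihoodMomentLE.pi`), so `N` published rows, be
they the `m` rows of one sketch or the `q m` rows of all sketches, cost `2 N r² (s + 2 s²)`. Markov's
inequality turns this into `(ε, exp (2 N r² (s + 2 s²) - s ε))`-privacy
(`LikelihoodMomentLE.measure_le`). With `s = 3 β / (2 ε)` the bound on the sketch size makes the
cost at most `β / 2` (`total_moment_le`), and the exponent is at most `-β = log (δ / 4)`.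
-/

/-! ### Moments of likelihood ratios -/

/-- `μ` has a density `f` with respect to `ν`, and the `s`-th moment of `f` under `μ` is at most
`exp K`. Equivalently, the Rényi divergence of order `1 + s` of `μ` from `ν` is at most `K / s`. -/
def LikelihoodMomentLE {α : Type*} [MeasurableSpace α] (s K : ℝ) (μ ν : Measure α) : Prop :=
  ∃ f : α → ℝ≥0∞, Measurable f ∧ μ = ν.withDensity f ∧
    ∫⁻ x, f x ^ s ∂μ ≤ ENNReal.ofReal (Real.exp K)

theorem lintegral_pi_prod_eq_prod {ι : Type*} [Fintype ι] {α : ι → Type*}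
    [∀ i, MeasurableSpace (α i)] (μ : ∀ i, Measure (α i)) [∀ i, IsProbabilityMeasure (μ i)]
    {f : ∀ i, α i → ℝ≥0∞} (hf : ∀ i, Measurable (f i)) :
    ∫⁻ x, ∏ i, f i (x i) ∂(Measure.pi μ) = ∏ i, ∫⁻ x, f i x ∂(μ i) := by
  have hind : iIndepFun (fun i (x : ∀ i, α i) => f i (x i)) (Measure.pi μ) :=
    iIndepFun_pi fun i => (hf i).aemeasurable
  rw [lintegral_prod_eq_prod_lintegral_of_indepFun Finset.univ _ hind
    fun i => (hf i).comp (measurable_pi_apply i)]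
  refine Finset.prod_congr rfl fun i _ => ?_
  exact (measurePreserving_eval μ i).lintegral_comp (hf i)

theorem pi_withDensity {ι : Type*} [Fintype ι] {α : ι → Type*}
    [∀ i, MeasurableSpace (α i)] (ν : ∀ i, Measure (α i)) [∀ i, IsProbabilityMeasure (ν i)]
    {f : ∀ i, α i → ℝ≥0∞} (hf : ∀ i, Measurable (f i))
    [∀ i, SigmaFinite ((ν i).withDensity (f i))] :
    Measure.pi (fun i => (ν i).withDensity (f i)) =
      (Measure.pi ν).withDensity fun x => ∏ i, f i (x i) := by
  refine Measure.pi_eq fun t ht => ?_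
  rw [withDensity_apply _ (MeasurableSet.univ_pi ht),
    ← lintegral_indicator (MeasurableSet.univ_pi ht)]
  have hprod : (Set.univ.pi t).indicator (fun x : ∀ i, α i => ∏ i, f i (x i)) =
      fun x => ∏ i, (t i).indicator (f i) (x i) := by
    classical
    funext x
    by_cases hx : x ∈ Set.univ.pi t
    · rw [Set.indicator_of_mem hx]
      exact Finset.prod_congr rfl fun i _ => (Set.indicator_of_mem (hx i (Set.mem_univ i)) _).symm
    · rw [Set.indicator_of_notMem hx]
      obtain ⟨i, hi⟩ : ∃ i, x i ∉ t i := by simpa [Set.mem_pi] using hx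
      exact (Finset.prod_eq_zero (Finset.mem_univ i) (Set.indicator_of_notMem hi _)).symm
  rw [hprod, lintegral_pi_prod_eq_prod ν fun i => (hf i).indicator (ht i)]
  exact Finset.prod_congr rfl fun i _ => by
    rw [withDensity_apply _ (ht i), lintegral_indicator (ht i)]

namespace LikelihoodMomentLE

theorem mono {α : Type*} [MeasurableSpace α] {s K K' : ℝ} {μ ν : Measure α}
    (h : LikelihoodMomentLE s K μ ν) (hK : K ≤ K') : LikelihoodMomentLE s K' μ ν := by
  obtain ⟨f, hf, hμ, hm⟩ := h
  exact ⟨f, hf, hμ, hm.trans (ENNReal.ofReal_le_ofReal (Real.exp_le_exp.2 hK))⟩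

/-- Rényi divergences add over independent components. -/
theorem pi {ι : Type*} [Fintype ι] {α : ι → Type*} [∀ i, MeasurableSpace (α i)] {s : ℝ}
    (hs : 0 ≤ s) {K : ι → ℝ} {μ ν : ∀ i, Measure (α i)} [∀ i, IsProbabilityMeasure (μ i)]
    [∀ i, IsProbabilityMeasure (ν i)] (h : ∀ i, LikelihoodMomentLE s (K i) (μ i) (ν i)) :
    LikelihoodMomentLE s (∑ i, K i) (Measure.pi μ) (Measure.pi ν) := by
  choose f hf hμ hm using h
  refine ⟨fun x => ∏ i, f i (x i), by fun_prop, ?_, ?_⟩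
  · have : ∀ i, SigmaFinite ((ν i).withDensity (f i)) := fun i => hμ i ▸ inferInstance
    rw [← pi_withDensity ν hf]
    exact congrArg Measure.pi (funext hμ)
  · simp_rw [← ENNReal.prod_rpow_of_nonneg hs]
    rw [lintegral_pi_prod_eq_prod μ fun i => (hf i).pow_const s, Real.exp_sum,
      ENNReal.ofReal_prod_of_nonneg fun i _ => (Real.exp_pos _).le]
    exact Finset.prod_le_prod' fun i _ => hm i

theorem map_equiv {α β : Type*} [MeasurableSpace α] [MeasurableSpace β] {s K : ℝ}
    {μ ν : Measure α} (h : LikelihoodMomentLE s K μ ν) (e : α ≃ᵐ β) :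
    LikelihoodMomentLE s K (μ.map e) (ν.map e) := by
  obtain ⟨f, hf, hμ, hm⟩ := h
  refine ⟨f ∘ e.symm, hf.comp e.symm.measurable, ?_, ?_⟩
  · ext t ht
    rw [Measure.map_apply e.measurable ht, hμ, withDensity_apply _ (e.measurable ht),
      withDensity_apply _ ht, setLIntegral_map ht (hf.comp e.symm.measurable) e.measurable]
    simp
  · rw [lintegral_map ((hf.comp e.symm.measurable).pow_const s) e.measurable]
    simpa using hm

/-- A bounded likelihood moment yields an approximate likelihood bound on every event: off the
event `f > exp ε` the density gives the factor `exp ε`, and Markov's inequality for `f ^ s` bounds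
the measure of that event. -/
theorem measure_le {α : Type*} [MeasurableSpace α] {s K ε : ℝ} {μ ν : Measure α} (hs : 0 < s)
    (h : LikelihoodMomentLE s K μ ν) {T : Set α} (hT : MeasurableSet T) :
    μ T ≤ ENNReal.ofReal (Real.exp ε) * ν T + ENNReal.ofReal (Real.exp (K - s * ε)) := by
  obtain ⟨f, hf, hμ, hm⟩ := h
  have hmeas : MeasurableSet {x | f x ≤ ENNReal.ofReal (Real.exp ε)} :=
    measurableSet_le hf measurable_const
  have hgood : μ (T ∩ {x | f x ≤ ENNReal.ofReal (Real.exp ε)}) ≤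
      ENNReal.ofReal (Real.exp ε) * ν T := by
    rw [hμ, withDensity_apply _ (hT.inter hmeas)]
    calc ∫⁻ x in T ∩ {x | f x ≤ ENNReal.ofReal (Real.exp ε)}, f x ∂ν
        ≤ ∫⁻ _ in T ∩ {x | f x ≤ ENNReal.ofReal (Real.exp ε)}, ENNReal.ofReal (Real.exp ε) ∂ν :=
          setLIntegral_mono measurable_const fun x hx => hx.2
      _ ≤ _ := by
          rw [setLIntegral_const]
          gcongr
          exact Set.inter_subset_left
  have hbad : μ {x | f x ≤ ENNReal.ofReal (Real.exp ε)}ᶜ ≤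
      ENNReal.ofReal (Real.exp (K - s * ε)) := by
    have hsub : {x | f x ≤ ENNReal.ofReal (Real.exp ε)}ᶜ ⊆
        {x | ENNReal.ofReal (Real.exp (s * ε)) ≤ f x ^ s} := by
      intro x hx
      have hx' : ENNReal.ofReal (Real.exp ε) ≤ f x := (not_le.1 (show ¬ f x ≤ _ from hx)).le
      calc ENNReal.ofReal (Real.exp (s * ε)) = ENNReal.ofReal (Real.exp ε) ^ s := by
            rw [ENNReal.ofReal_rpow_of_pos (Real.exp_pos _), ← Real.exp_mul, mul_comm]
        _ ≤ f x ^ s := ENNReal.rpow_le_rpow hx' hs.le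
    refine (measure_mono hsub).trans ?_
    refine (meas_ge_le_lintegral_div (hf.pow_const s).aemeasurable (by positivity)
      ENNReal.ofReal_ne_top).trans ?_
    rw [Real.exp_sub, ENNReal.ofReal_div_of_pos (Real.exp_pos _)]
    gcongr
  calc μ T ≤ μ (T ∩ {x | f x ≤ ENNReal.ofReal (Real.exp ε)}) +
        μ (T \ {x | f x ≤ ENNReal.ofReal (Real.exp ε)}) := measure_le_inter_add_sdiff _ _ _
    _ ≤ _ := add_le_add hgood ((measure_mono fun x hx => hx.2).trans hbad)

end LikelihoodMomentLE

/-! ### Centred Gaussians on the line -/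

/-- The logarithm of the likelihood moment of two centred Gaussians with variance ratio `D` is
quadratic in `D - 1`: the terms linear in `D - 1` cancel. -/
theorem gaussian_log_moment_le {s D : ℝ} (hs : 0 ≤ s) (hD : 1 / 2 ≤ D)
    (hsD : s * (D - 1) ≤ 3 / 4) :
    -(s / 2) * Real.log D - Real.log (1 + s * (1 - D)) / 2 ≤ (D - 1) ^ 2 * (s + 2 * s ^ 2) := by
  have hD0 : 0 < D := by linarith
  have hy : 1 / 4 ≤ 1 + s * (1 - D) := by linarith
  have hy0 : 0 < 1 + s * (1 - D) := by linarith
  have hlogD : (D - 1) - 2 * (D - 1) ^ 2 ≤ Real.log D := by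
    refine le_trans ?_ (Real.one_sub_inv_le_log_of_pos hD0)
    have : 1 - D⁻¹ - ((D - 1) - 2 * (D - 1) ^ 2) = (D - 1) ^ 2 * (2 * D - 1) / D := by
      field_simp; ring
    have : 0 ≤ (D - 1) ^ 2 * (2 * D - 1) / D :=
      div_nonneg (mul_nonneg (sq_nonneg _) (by linarith)) hD0.le
    linarith
  have hlogy : s * (1 - D) - 4 * (s * (1 - D)) ^ 2 ≤ Real.log (1 + s * (1 - D)) := by
    refine le_trans ?_ (Real.one_sub_inv_le_log_of_pos hy0)
    generalize s * (1 - D) = t at hy hy0 ⊢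
    have : 1 - (1 + t)⁻¹ - (t - 4 * t ^ 2) = t ^ 2 * (3 + 4 * t) / (1 + t) := by
      field_simp; ring
    have : 0 ≤ t ^ 2 * (3 + 4 * t) / (1 + t) :=
      div_nonneg (mul_nonneg (sq_nonneg _) (by linarith)) hy0.le
    linarith
  have := mul_le_mul_of_nonneg_left hlogD (by linarith : 0 ≤ s / 2)
  nlinarith

/-- The density of `N(0, v D)` with respect to `N(0, v)` is
`D ^ (-1/2) * exp (-(D⁻¹ - 1) x² / (2 v))`, and its `s`-th moment under `N(0, v D)` is the Gaussian
integral `D ^ (-s/2) * (1 + s (1 - D)) ^ (-1/2)`, which is finite as long as `s (D - 1) < 1`. -/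
theorem likelihoodMomentLE_gaussianReal {s : ℝ} {v D : ℝ≥0} (hv : v ≠ 0) (hs : 0 ≤ s)
    (hD : 1 / 2 ≤ (D : ℝ)) (hsD : s * ((D : ℝ) - 1) ≤ 3 / 4) :
    LikelihoodMomentLE s (((D : ℝ) - 1) ^ 2 * (s + 2 * s ^ 2))
      (gaussianReal 0 (v * D)) (gaussianReal 0 v) := by
  have hv0 : (0 : ℝ) < v := by positivity
  have hD0 : (0 : ℝ) < D := by linarith
  have hDne : D ≠ 0 := by rintro rfl; simp at hD0
  have hy0 : 0 < 1 + s * (1 - (D : ℝ)) := by linarith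
  set g : ℝ → ℝ := fun x => (√(D : ℝ))⁻¹ * Real.exp (-((D : ℝ)⁻¹ - 1) * x ^ 2 / (2 * v)) with hg
  have hgpos : ∀ x, 0 < g x := fun x => by positivity
  have hgm : Measurable fun x => ENNReal.ofReal (g x) := by fun_prop
  refine ⟨fun x => ENNReal.ofReal (g x), hgm, ?_, ?_⟩
  · rw [gaussianReal_of_var_ne_zero _ (mul_ne_zero hv hDne), gaussianReal_of_var_ne_zero _ hv,
      ← withDensity_mul _ (measurable_gaussianPDF 0 v) hgm]
    congr 1
    funext x
    rw [Pi.mul_apply, gaussianPDF, gaussianPDF, ← ENNReal.ofReal_mul (gaussianPDFReal_nonneg _ _ _)]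
    congr 1
    simp only [gaussianPDFReal, hg, sub_zero, NNReal.coe_mul]
    rw [← mul_assoc (2 * Real.pi), Real.sqrt_mul (by positivity), mul_inv, mul_mul_mul_comm,
      ← Real.exp_add]
    congr 2
    field_simp
    ring
  · set b : ℝ := (1 + s * (1 - (D : ℝ))) / (2 * v * D) with hb
    have hb0 : 0 < b := by positivity
    have key : ∀ x, gaussianPDFReal 0 (v * D) x * g x ^ s =
        ((√(2 * Real.pi * (v * D)))⁻¹ * (√(D : ℝ))⁻¹ ^ s) * Real.exp (-b * x ^ 2) := by
      intro x
      simp only [gaussianPDFReal, hg, sub_zero, NNReal.coe_mul]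
      rw [Real.mul_rpow (by positivity) (Real.exp_pos _).le, ← Real.exp_mul, mul_mul_mul_comm,
        ← Real.exp_add]
      congr 2
      rw [hb]
      field_simp
      ring
    have hlin : ∫⁻ x, ENNReal.ofReal (g x) ^ s ∂(gaussianReal 0 (v * D)) =
        ENNReal.ofReal (∫ x, ((√(2 * Real.pi * (v * D)))⁻¹ * (√(D : ℝ))⁻¹ ^ s) *
          Real.exp (-b * x ^ 2)) := by
      rw [ofReal_integral_eq_lintegral_ofReal ((integrable_exp_neg_mul_sq hb0).const_mul _)
        (ae_of_all _ fun x => by positivity),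
        gaussianReal_of_var_ne_zero _ (mul_ne_zero hv hDne),
        lintegral_withDensity_eq_lintegral_mul _ (measurable_gaussianPDF _ _) (hgm.pow_const s)]
      refine lintegral_congr fun x => ?_
      rw [Pi.mul_apply, gaussianPDF, ENNReal.ofReal_rpow_of_pos (hgpos x),
        ← ENNReal.ofReal_mul (gaussianPDFReal_nonneg _ _ _), key]
    rw [hlin]
    refine ENNReal.ofReal_le_ofReal ?_
    rw [integral_const_mul, integral_gaussian]
    have hsqrt : √(Real.pi / b) = √(2 * Real.pi * (v * D)) * (√(1 + s * (1 - (D : ℝ))))⁻¹ := by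
      rw [← Real.sqrt_inv, ← Real.sqrt_mul (by positivity)]
      congr 1
      rw [hb]
      field_simp
    have hne : √(2 * Real.pi * (v * D)) ≠ 0 := by positivity
    have hexp : ((√(2 * Real.pi * (v * D)))⁻¹ * (√(D : ℝ))⁻¹ ^ s) * √(Real.pi / b) =
        Real.exp (-(s / 2) * Real.log D - Real.log (1 + s * (1 - (D : ℝ))) / 2) := by
      rw [hsqrt, Real.exp_sub, Real.rpow_def_of_pos (by positivity), Real.log_inv,
        Real.log_sqrt hD0.le, ← Real.log_sqrt hy0.le, Real.exp_log (by positivity)]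
      rw [show -(Real.log D / 2) * s = -(s / 2) * Real.log D by ring]
      field_simp
    rw [hexp]
    exact Real.exp_le_exp.2 (gaussian_log_moment_le hs hD hsD)

/-! ### The law of one row of a Gaussian sketch -/

/-- The law of `g ᵥ* X`, where `g` is a vector of independent `N(0, v)` variables; this is the law
of each row of `S * X` for a Gaussian sketch `S`. -/
noncomputable def sketchRowLaw {ι κ : Type*} [Fintype ι] (v : ℝ≥0) (X : Matrix ι κ ℝ) :
    Measure (κ → ℝ) :=
  (Measure.pi fun _ : ι => gaussianReal 0 v).map fun g => g ᵥ* X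

theorem measurable_vecMul {ι κ : Type*} [Fintype ι] (X : Matrix ι κ ℝ) :
    Measurable fun g : ι → ℝ => g ᵥ* X := by
  refine measurable_pi_lambda _ fun k => ?_
  simp only [Matrix.vecMul, dotProduct]
  fun_prop

instance isProbabilityMeasure_sketchRowLaw {ι κ : Type*} [Fintype ι] (v : ℝ≥0)
    (X : Matrix ι κ ℝ) : IsProbabilityMeasure (sketchRowLaw v X) :=
  Measure.isProbabilityMeasure_map (measurable_vecMul X).aemeasurable

/-- The characteristic function of a sketched row is `exp (-v tᵀ Xᵀ X t / 2)`; the functional `L` is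
given by its coefficient vector `t`. -/
theorem charFunDual_sketchRowLaw {ι κ : Type*} [Fintype ι] [Fintype κ] (v : ℝ≥0)
    (X : Matrix ι κ ℝ) (L : StrongDual ℝ (κ → ℝ)) (t : κ → ℝ) (hL : ∀ y, L y = y ⬝ᵥ t) :
    charFunDual (sketchRowLaw v X) L =
      Complex.exp (-((v * (t ⬝ᵥ (Xᵀ * X) *ᵥ t) / 2 : ℝ) : ℂ)) := by
  have hLm : Measurable fun y => Complex.exp ((L y : ℂ) * Complex.I) := by fun_prop
  rw [charFunDual_apply, sketchRowLaw, integral_map (measurable_vecMul X).aemeasurable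
    hLm.aestronglyMeasurable]
  have hsum : ∀ g : ι → ℝ, L (g ᵥ* X) = ∑ i, (X *ᵥ t) i * g i := fun g => by
    rw [hL, ← Matrix.dotProduct_mulVec, dotProduct]
    exact Finset.sum_congr rfl fun i _ => mul_comm _ _
  simp_rw [hsum, Complex.ofReal_sum, Finset.sum_mul, Complex.exp_sum, Complex.ofReal_mul]
  rw [integral_fintype_prod_eq_prod
    (f := fun i (x : ℝ) => Complex.exp (((X *ᵥ t) i : ℂ) * x * Complex.I))]
  simp_rw [← charFun_apply_real, charFun_gaussianReal]
  rw [← Complex.exp_sum]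
  congr 1
  have hq : t ⬝ᵥ (Xᵀ * X) *ᵥ t = ∑ i, (X *ᵥ t) i ^ 2 := by
    rw [← Matrix.mulVec_mulVec, Matrix.dotProduct_mulVec, Matrix.vecMul_transpose, dotProduct]
    exact Finset.sum_congr rfl fun i _ => (sq _).symm
  rw [hq]
  push_cast
  simp [Finset.mul_sum, Finset.sum_div]

/-- The law of a sketched row depends on the data only through its Gram matrix. -/
theorem sketchRowLaw_congr {ι ι' κ : Type*} [Fintype ι] [Fintype ι'] [Fintype κ] (v : ℝ≥0)
    {X : Matrix ι κ ℝ} {X' : Matrix ι' κ ℝ} (h : Xᵀ * X = X'ᵀ * X') :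
    sketchRowLaw v X = sketchRowLaw v X' := by
  classical
  apply Measure.ext_of_charFunDual
  ext L
  have hL : ∀ y, L y = y ⬝ᵥ fun k => L (Pi.single k 1) := fun y => by
    conv_lhs => rw [← Finset.univ_sum_single y, map_sum]
    refine Finset.sum_congr rfl fun k _ => ?_
    rw [← smul_eq_mul, ← map_smul, ← Pi.single_smul, smul_eq_mul, mul_one]
  rw [charFunDual_sketchRowLaw v X L _ hL, charFunDual_sketchRowLaw v X' L _ hL, h]

theorem sketchRowLaw_mul {ι κ κ' : Type*} [Fintype ι] [Fintype κ] (v : ℝ≥0)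
    (X : Matrix ι κ ℝ) (W : Matrix κ κ' ℝ) :
    sketchRowLaw v (X * W) = (sketchRowLaw v X).map fun y => y ᵥ* W := by
  rw [sketchRowLaw, sketchRowLaw, Measure.map_map (measurable_vecMul W) (measurable_vecMul X)]
  congr 1
  funext g
  simp [Matrix.vecMul_vecMul]

/-- Data with Gram matrix `diagonal D` produce independent Gaussian coordinates. -/
theorem sketchRowLaw_diagonal_sqrt {κ : Type*} [Fintype κ] [DecidableEq κ] (v : ℝ≥0)
    (D : κ → ℝ≥0) :
    sketchRowLaw v (Matrix.diagonal fun j => √(D j : ℝ)) =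
      Measure.pi fun j => gaussianReal 0 (v * D j) := by
  have hm : ∀ j, (gaussianReal 0 v).map (· * √(D j : ℝ)) = gaussianReal 0 (v * D j) := fun j => by
    rw [gaussianReal_map_mul_const, mul_zero, mul_comm]
    congr 2
    ext
    simp
  have : ∀ j, SigmaFinite ((gaussianReal 0 v).map (· * √(D j : ℝ))) := fun j => by
    rw [hm]; infer_instance
  rw [← funext hm, ← Measure.pi_map_pi fun j => by fun_prop, sketchRowLaw]
  congr 1
  funext g j
  simp [Matrix.vecMul_diagonal]

theorem sketchRowLaw_one {κ : Type*} [Fintype κ] [DecidableEq κ] (v : ℝ≥0) :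
    sketchRowLaw v (1 : Matrix κ κ ℝ) = Measure.pi fun _ : κ => gaussianReal 0 v := by
  simp [sketchRowLaw]

/-- Right multiplication of row vectors by an invertible matrix, as a measurable equivalence. -/
def vecMulMeasurableEquiv {κ : Type*} [Fintype κ] [DecidableEq κ] (W V : Matrix κ κ ℝ)
    (hWV : W * V = 1) (hVW : V * W = 1) : (κ → ℝ) ≃ᵐ (κ → ℝ) where
  toFun y := y ᵥ* W
  invFun y := y ᵥ* V
  left_inv y := by simp [Matrix.vecMul_vecMul, hWV]
  right_inv y := by simp [Matrix.vecMul_vecMul, hVW]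
  measurable_toFun := measurable_vecMul W
  measurable_invFun := measurable_vecMul V

/-- In a basis that diagonalizes both Gram matrices, the two row laws become products of Gaussians
with variances `v * D j` and `v`; the change of basis is invertible and preserves moments. -/
theorem likelihoodMomentLE_sketchRowLaw {ι κ : Type*} [Fintype ι] [Fintype κ] [DecidableEq κ]
    {s : ℝ} {v : ℝ≥0} (hv : v ≠ 0) (hs : 0 ≤ s) {X Y : Matrix ι κ ℝ} {W V : Matrix κ κ ℝ}
    {D : κ → ℝ} (hWV : W * V = 1) (hVW : V * W = 1) (hY : Yᵀ * Y = Wᵀ * W)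
    (hX : Xᵀ * X = Wᵀ * Matrix.diagonal D * W) (hD : ∀ j, 1 / 2 ≤ D j)
    (hsD : ∀ j, s * (D j - 1) ≤ 3 / 4) :
    LikelihoodMomentLE s (∑ j, (D j - 1) ^ 2 * (s + 2 * s ^ 2))
      (sketchRowLaw v X) (sketchRowLaw v Y) := by
  have hD0 : ∀ j, 0 ≤ D j := fun j => by linarith [hD j]
  lift D to κ → ℝ≥0 using hD0
  have hX' : Xᵀ * X = (Matrix.diagonal (fun j => √(D j : ℝ)) * W)ᵀ *
      (Matrix.diagonal (fun j => √(D j : ℝ)) * W) := by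
    rw [hX, Matrix.transpose_mul, Matrix.diagonal_transpose, Matrix.mul_assoc,
      Matrix.mul_assoc Wᵀ, ← Matrix.mul_assoc (Matrix.diagonal _) (Matrix.diagonal _) W,
      Matrix.diagonal_mul_diagonal]
    simp
  have hY' : Yᵀ * Y = (1 * W)ᵀ * (1 * W) := by rw [hY, Matrix.one_mul]
  rw [sketchRowLaw_congr v hX', sketchRowLaw_congr v hY', sketchRowLaw_mul, sketchRowLaw_mul,
    sketchRowLaw_diagonal_sqrt, sketchRowLaw_one]
  exact (LikelihoodMomentLE.pi hs fun j =>
    likelihoodMomentLE_gaussianReal hv hs (hD j) (hsD j)).map_equiv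
      (vecMulMeasurableEquiv W V hWV hVW)

/-! ### Simultaneous diagonalization of two Gram matrices -/

/-- A positive definite and a symmetric form have a common orthogonal basis. -/
theorem Matrix.PosDef.exists_simultaneous_diagonalization {κ : Type*} [Fintype κ] [DecidableEq κ]
    {P Q : Matrix κ κ ℝ} (hQ : Q.PosDef) (hP : P.IsSymm) :
    ∃ (W V : Matrix κ κ ℝ) (D : κ → ℝ), W * V = 1 ∧ V * W = 1 ∧ Q = Wᵀ * W ∧
      P = Wᵀ * Matrix.diagonal D * W := by
  open scoped MatrixOrder in
  obtain ⟨R, hR⟩ := CStarAlgebra.nonneg_iff_eq_star_mul_self.mp hQ.posSemidef.nonneg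
  rw [Matrix.star_eq_conjTranspose, Matrix.conjTranspose_eq_transpose_of_trivial] at hR
  have hRdet : IsUnit R.det := by
    have h := (Matrix.isUnit_iff_isUnit_det _).1 hQ.isUnit
    rw [hR, Matrix.det_mul] at h
    exact isUnit_of_mul_isUnit_right h
  have hM : (R⁻¹ᵀ * P * R⁻¹).IsHermitian := by
    rw [Matrix.IsHermitian, Matrix.conjTranspose_eq_transpose_of_trivial, Matrix.transpose_mul,
      Matrix.transpose_mul, Matrix.transpose_transpose, hP.eq, Matrix.mul_assoc]
  set U : Matrix κ κ ℝ := (hM.eigenvectorUnitary : Matrix κ κ ℝ) with hU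
  have hUU : Uᵀ * U = 1 := by
    have := Unitary.coe_star_mul_self hM.eigenvectorUnitary
    rwa [Matrix.star_eq_conjTranspose, Matrix.conjTranspose_eq_transpose_of_trivial] at this
  have hUU' : U * Uᵀ = 1 := mul_eq_one_comm.1 hUU
  have hspec : R⁻¹ᵀ * P * R⁻¹ = U * Matrix.diagonal hM.eigenvalues * Uᵀ := by
    have := hM.spectral_theorem
    rw [Unitary.conjStarAlgAut_apply, Matrix.star_eq_conjTranspose,
      Matrix.conjTranspose_eq_transpose_of_trivial] at this
    exact this
  have hRR : R⁻¹ * R = 1 := Matrix.nonsing_inv_mul R hRdet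
  have hRR' : R * R⁻¹ = 1 := Matrix.mul_nonsing_inv R hRdet
  have hRT : Rᵀ * R⁻¹ᵀ = 1 := by rw [← Matrix.transpose_mul, hRR, Matrix.transpose_one]
  refine ⟨Uᵀ * R, R⁻¹ * U, hM.eigenvalues, ?_, ?_, ?_, ?_⟩
  · calc Uᵀ * R * (R⁻¹ * U) = Uᵀ * (R * R⁻¹) * U := by simp only [Matrix.mul_assoc]
      _ = 1 := by rw [hRR', Matrix.mul_one, hUU]
  · calc R⁻¹ * U * (Uᵀ * R) = R⁻¹ * (U * Uᵀ) * R := by simp only [Matrix.mul_assoc]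
      _ = 1 := by rw [hUU', Matrix.mul_one, hRR]
  · calc Q = Rᵀ * (U * Uᵀ) * R := by rw [hUU', Matrix.mul_one, hR]
      _ = (Uᵀ * R)ᵀ * (Uᵀ * R) := by
        rw [Matrix.transpose_mul, Matrix.transpose_transpose]; simp only [Matrix.mul_assoc]
  · calc P = (Rᵀ * R⁻¹ᵀ) * P * (R⁻¹ * R) := by rw [hRT, hRR, Matrix.one_mul, Matrix.mul_one]
      _ = Rᵀ * (R⁻¹ᵀ * P * R⁻¹) * R := by simp only [Matrix.mul_assoc]
      _ = Rᵀ * (U * Matrix.diagonal hM.eigenvalues * Uᵀ) * R :=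
        congrArg (fun N => Rᵀ * N * R) hspec
      _ = (Uᵀ * R)ᵀ * Matrix.diagonal hM.eigenvalues * (Uᵀ * R) := by
        rw [Matrix.transpose_mul, Matrix.transpose_transpose]
        simp only [Matrix.mul_assoc]

theorem dotProduct_self_nonneg {κ : Type*} [Fintype κ] (z : κ → ℝ) : 0 ≤ z ⬝ᵥ z :=
  Finset.sum_nonneg fun _ _ => mul_self_nonneg _

theorem sq_dotProduct_le {κ : Type*} [Fintype κ] (x z : κ → ℝ) :
    (x ⬝ᵥ z) ^ 2 ≤ (x ⬝ᵥ x) * (z ⬝ᵥ z) := by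
  simp only [dotProduct, ← sq]
  exact Finset.sum_mul_sq_le_sq_mul_sq Finset.univ x z

/-- If the form `Q` dominates `lam` times the Euclidean one and `V` is `Q`-orthonormal, then the
coordinates of `x` in the dual basis are small: this is `xᵀ Q⁻¹ x ≤ xᵀ x / lam`. -/
theorem dotProduct_vecMul_self_le {κ : Type*} [Fintype κ] [DecidableEq κ] {Q V : Matrix κ κ ℝ}
    {lam r : ℝ} (hlam : 0 < lam) (hQ : ∀ z, lam * (z ⬝ᵥ z) ≤ z ⬝ᵥ Q *ᵥ z)
    (hV : Vᵀ * Q * V = 1) {x : κ → ℝ} (hx : x ⬝ᵥ x ≤ r * lam) :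
    (x ᵥ* V) ⬝ᵥ (x ᵥ* V) ≤ r := by
  set a := x ᵥ* V with ha
  have hxz : x ⬝ᵥ (V *ᵥ a) = a ⬝ᵥ a := by rw [Matrix.dotProduct_mulVec]
  have hQz : (V *ᵥ a) ⬝ᵥ Q *ᵥ (V *ᵥ a) = a ⬝ᵥ a := by
    rw [← Matrix.vecMul_transpose V a, ← Matrix.dotProduct_mulVec, Matrix.mulVec_mulVec,
      Matrix.vecMul_transpose, Matrix.mulVec_mulVec, hV, Matrix.one_mulVec]
  have h1 := hQ (V *ᵥ a)
  have h2 := sq_dotProduct_le x (V *ᵥ a)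
  rw [hQz] at h1
  rw [hxz] at h2
  have hz0 : 0 ≤ (V *ᵥ a) ⬝ᵥ (V *ᵥ a) := dotProduct_self_nonneg _
  have hx0 : 0 ≤ x ⬝ᵥ x := dotProduct_self_nonneg _
  have hr0 : 0 ≤ r := by
    by_contra h
    nlinarith [mul_pos (neg_pos.2 (not_le.1 h)) hlam]
  by_contra! hlt
  have h3 : (a ⬝ᵥ a) ^ 2 ≤ r * (a ⬝ᵥ a) := by
    calc (a ⬝ᵥ a) ^ 2 ≤ (r * lam) * ((V *ᵥ a) ⬝ᵥ (V *ᵥ a)) :=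
          h2.trans (mul_le_mul_of_nonneg_right hx hz0)
      _ = r * (lam * ((V *ᵥ a) ⬝ᵥ (V *ᵥ a))) := by ring
      _ ≤ _ := mul_le_mul_of_nonneg_left h1 hr0
  nlinarith

/-- Two rank-one perturbations of a form `G ≥ lam` by vectors of squared norm at most `r * lam`:
their generalized eigenvalues `D j` are within `r` of `1`, and `D - 1` is square summable with a
bound that does not depend on the dimension. -/
theorem exists_diagonalization_of_rank_one_perturbations {κ : Type*} [Fintype κ] [DecidableEq κ]
    {G : Matrix κ κ ℝ} (hG : G.IsSymm) {lam r : ℝ} (hlam : 0 < lam) (hr : r ≤ 1)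
    (hGlam : ∀ z, lam * (z ⬝ᵥ z) ≤ z ⬝ᵥ G *ᵥ z) {x y : κ → ℝ} (hx : x ⬝ᵥ x ≤ r * lam)
    (hy : y ⬝ᵥ y ≤ r * lam) :
    ∃ (W V : Matrix κ κ ℝ) (D : κ → ℝ), W * V = 1 ∧ V * W = 1 ∧
      G + Matrix.vecMulVec y y = Wᵀ * W ∧
      G + Matrix.vecMulVec x x = Wᵀ * Matrix.diagonal D * W ∧
      (∀ j, 1 / 2 ≤ D j) ∧ (∀ j, D j - 1 ≤ r) ∧ ∑ j, (D j - 1) ^ 2 ≤ 2 * r ^ 2 := by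
  have hvec : ∀ u : κ → ℝ, (Matrix.vecMulVec u u).IsSymm := fun u => by
    rw [Matrix.IsSymm, Matrix.transpose_vecMulVec]
  have hquad : ∀ u z : κ → ℝ, z ⬝ᵥ (G + Matrix.vecMulVec u u) *ᵥ z =
      z ⬝ᵥ G *ᵥ z + (u ⬝ᵥ z) ^ 2 := fun u z => by
    rw [Matrix.add_mulVec, dotProduct_add, Matrix.vecMulVec_mulVec]
    simp [dotProduct_comm z u, sq]
  have hlow : ∀ u z : κ → ℝ, lam * (z ⬝ᵥ z) ≤ z ⬝ᵥ (G + Matrix.vecMulVec u u) *ᵥ z :=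
    fun u z => by rw [hquad]; nlinarith [hGlam z, sq_nonneg (u ⬝ᵥ z)]
  have hQ : (G + Matrix.vecMulVec y y).PosDef := by
    refine .of_dotProduct_mulVec_pos ?_ fun z hz => ?_
    · rw [Matrix.IsHermitian, Matrix.conjTranspose_eq_transpose_of_trivial]
      exact hG.add (hvec y)
    · have hzz : 0 < z ⬝ᵥ z := by
        have : 0 ≤ z ⬝ᵥ z := dotProduct_self_nonneg _
        exact lt_of_le_of_ne this fun h => hz (dotProduct_self_eq_zero.1 h.symm)
      rw [star_trivial]
      exact (mul_pos hlam hzz).trans_le (hlow y z)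
  obtain ⟨W, V, D, hWV, hVW, hQW, hPW⟩ :=
    hQ.exists_simultaneous_diagonalization (hG.add (hvec x))
  have hWVT : Vᵀ * Wᵀ = 1 := by rw [← Matrix.transpose_mul, hWV, Matrix.transpose_one]
  have hVQ : Vᵀ * (G + Matrix.vecMulVec y y) * V = 1 := by
    rw [hQW, ← Matrix.mul_assoc, hWVT, Matrix.one_mul, hWV]
  have hVP : Vᵀ * (G + Matrix.vecMulVec x x) * V = Matrix.diagonal D := by
    rw [hPW]
    calc Vᵀ * (Wᵀ * Matrix.diagonal D * W) * V
        = (Vᵀ * Wᵀ) * Matrix.diagonal D * (W * V) := by simp only [Matrix.mul_assoc]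
      _ = _ := by rw [hWVT, hWV, Matrix.one_mul, Matrix.mul_one]
  -- In the basis of columns of `V`, the forms `G + y yᵀ` and `G + x xᵀ` have diagonal entries
  -- `g j + b j ^ 2 = 1` and `g j + a j ^ 2 = D j`, whence `D j - 1 = a j ^ 2 - b j ^ 2`.
  set a := x ᵥ* V with ha
  set b := y ᵥ* V with hb
  set g : κ → ℝ := fun j => (Vᵀ j) ⬝ᵥ G *ᵥ (Vᵀ j) with hg
  have hentry : ∀ (N : Matrix κ κ ℝ) j, (Vᵀ * N * V) j j = (Vᵀ j) ⬝ᵥ N *ᵥ (Vᵀ j) := fun N j => by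
    rw [Matrix.mul_assoc]
    rfl
  have hbg : ∀ j, g j + b j ^ 2 = 1 := fun j => by
    have := congrFun (congrFun hVQ j) j
    rw [hentry, hquad, Matrix.one_apply_eq] at this
    exact this
  have hag : ∀ j, g j + a j ^ 2 = D j := fun j => by
    have := congrFun (congrFun hVP j) j
    rw [hentry, hquad, Matrix.diagonal_apply_eq] at this
    exact this
  have hbr : b ⬝ᵥ b ≤ r := dotProduct_vecMul_self_le hlam (hlow y) hVQ hy
  have har : a ⬝ᵥ a ≤ r := dotProduct_vecMul_self_le hlam (hlow y) hVQ hx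
  have hcoord : ∀ (c : κ → ℝ) j, c j ^ 2 ≤ c ⬝ᵥ c := fun c j => by
    rw [dotProduct, sq]
    exact Finset.single_le_sum (f := fun i => c i * c i) (fun i _ => mul_self_nonneg _)
      (Finset.mem_univ j)
  -- This bounds `D j` away from zero: `b j ^ 2 ≤ g j` and `g j + b j ^ 2 = 1` give `g j ≥ 1 / 2`.
  have hbhalf : ∀ j, b j ^ 2 ≤ g j := fun j => by
    have h1 : b j ^ 2 ≤ (y ⬝ᵥ y) * (Vᵀ j ⬝ᵥ Vᵀ j) := sq_dotProduct_le y (Vᵀ j)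
    have h0 : 0 ≤ Vᵀ j ⬝ᵥ Vᵀ j := dotProduct_self_nonneg _
    calc b j ^ 2 ≤ (1 * lam) * (Vᵀ j ⬝ᵥ Vᵀ j) := h1.trans (mul_le_mul_of_nonneg_right
          (hy.trans (mul_le_mul_of_nonneg_right hr hlam.le)) h0)
      _ ≤ g j := by rw [one_mul]; exact hGlam _
  have hsub : ∀ j, D j - 1 = a j ^ 2 - b j ^ 2 := fun j => by linarith [hbg j, hag j]
  refine ⟨W, V, D, hWV, hVW, hQW, hPW, fun j => ?_, fun j => ?_, ?_⟩
  · nlinarith [hbg j, hag j, hbhalf j, sq_nonneg (a j)]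
  · rw [hsub]
    linarith [hcoord a j, sq_nonneg (b j)]
  · calc ∑ j, (D j - 1) ^ 2 ≤ ∑ j, r * (a j * a j + b j * b j) := by
          refine Finset.sum_le_sum fun j _ => ?_
          rw [hsub]
          have h1 := (hcoord a j).trans har
          have h2 := (hcoord b j).trans hbr
          nlinarith [mul_nonneg (sq_nonneg (a j)) (sub_nonneg.2 h1),
            mul_nonneg (sq_nonneg (b j)) (sub_nonneg.2 h2),
            mul_nonneg (sq_nonneg (a j)) (sq_nonneg (b j))]
      _ = r * (a ⬝ᵥ a + b ⬝ᵥ b) := by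
          rw [← Finset.mul_sum, Finset.sum_add_distrib]; rfl
      _ ≤ 2 * r ^ 2 := by
          have hr0 : 0 ≤ r := (dotProduct_self_nonneg a).trans har
          nlinarith

/-! ### Neighboring data sets and singular values -/

theorem abs_entry_le_maxAbsEntry {ι κ : Type*} [Finite ι] [Finite κ] (M : Matrix ι κ ℝ) (i : ι)
    (k : κ) : |M i k| ≤ maxAbsEntry M :=
  le_ciSup (f := fun p : ι × κ => |M p.1 p.2|) (Set.finite_range _).bddAbove (i, k)

theorem dotProduct_row_self_le {ι κ : Type*} [Finite ι] [Fintype κ] {M : Matrix ι κ ℝ} {B : ℝ}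
    (hB : maxAbsEntry M ≤ B) (i : ι) : M i ⬝ᵥ M i ≤ Fintype.card κ * B ^ 2 := by
  calc M i ⬝ᵥ M i ≤ ∑ _k : κ, B ^ 2 := by
        refine Finset.sum_le_sum fun k _ => ?_
        rw [← sq, ← sq_abs]
        exact pow_le_pow_left₀ (abs_nonneg _) ((abs_entry_le_maxAbsEntry M i k).trans hB) 2
    _ = _ := by simp

/-- The square of the smallest nonzero singular value bounds the Gram form of a matrix with full
column rank from below. -/
theorem sq_sigmaMin_mul_le {ι κ : Type*} [Fintype ι] [Fintype κ] [DecidableEq κ]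
    {M : Matrix ι κ ℝ} (hM : M.rank = Fintype.card κ) (z : κ → ℝ) :
    sigmaMin M ^ 2 * (z ⬝ᵥ z) ≤ (M *ᵥ z) ⬝ᵥ (M *ᵥ z) := by
  set T := Matrix.toEuclideanLin M with hT
  have hfin : Module.finrank ℝ (EuclideanSpace ℝ κ) = Fintype.card κ := by simp
  have hrange : Module.finrank ℝ T.range = Fintype.card κ := by
    rw [← hM, Matrix.rank_eq_finrank_range_toLin M (EuclideanSpace.basisFun ι ℝ).toBasis
      (EuclideanSpace.basisFun κ ℝ).toBasis]
    rfl
  have hsym := T.isSymmetric_adjoint_comp_self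
  have hnonneg : 0 ≤ sigmaMin M := by
    refine Real.sInf_nonneg ?_
    rintro _ ⟨⟨i, rfl⟩, -⟩
    exact T.singularValues_nonneg i
  have hle : ∀ i : Fin (Fintype.card κ), sigmaMin M ^ 2 ≤ hsym.eigenvalues hfin i := fun i => by
    rw [← T.sq_singularValues_fin hfin i]
    refine pow_le_pow_left₀ hnonneg (csInf_le ⟨0, ?_⟩ ⟨⟨i, rfl⟩, ?_⟩) 2
    · rintro _ ⟨⟨i, rfl⟩, -⟩
      exact T.singularValues_nonneg i
    · exact (T.singularValues_pos_iff_lt_finrank_range.2 (by rw [hrange]; exact i.2)).ne'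
  set w : EuclideanSpace ℝ κ := WithLp.toLp 2 z with hw
  have hwz : z ⬝ᵥ z = ‖w‖ ^ 2 := by
    rw [EuclideanSpace.real_norm_sq_eq]
    exact Finset.sum_congr rfl fun k _ => (sq _).symm
  have hTw : (M *ᵥ z) ⬝ᵥ (M *ᵥ z) = ‖T w‖ ^ 2 := by
    rw [EuclideanSpace.real_norm_sq_eq]
    exact Finset.sum_congr rfl fun k _ => (sq _).symm
  set e := hsym.eigenvectorBasis hfin with he
  have hexp : ‖T w‖ ^ 2 = ∑ i, hsym.eigenvalues hfin i * inner ℝ (e i) w ^ 2 := by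
    rw [← real_inner_self_eq_norm_sq, ← LinearMap.adjoint_inner_left, ← e.sum_inner_mul_inner]
    refine Finset.sum_congr rfl fun i _ => ?_
    have h1 : inner ℝ (LinearMap.adjoint T (T w)) (e i) =
        hsym.eigenvalues hfin i * inner ℝ (e i) w := by
      have := hsym w (e i)
      rw [LinearMap.comp_apply] at this
      rw [this, hsym.apply_eigenvectorBasis, real_inner_smul_right, real_inner_comm]
      rfl
    rw [h1]
    ring
  rw [hwz, hTw, hexp, ← e.sum_sq_inner_right, Finset.mul_sum]
  exact Finset.sum_le_sum fun i _ => mul_le_mul_of_nonneg_right (hle i) (sq_nonneg _)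

/-- The contribution of row `i` to the Gram matrix is a rank-one term. -/
theorem gram_eq_updateRow_add {ι κ : Type*} [Fintype ι] [DecidableEq ι]
    (X : Matrix ι κ ℝ) (i : ι) :
    Xᵀ * X = (X.updateRow i 0)ᵀ * X.updateRow i 0 + Matrix.vecMulVec (X i) (X i) := by
  ext a b
  rw [Matrix.add_apply, Matrix.mul_apply, Matrix.mul_apply,
    ← Finset.add_sum_erase _ _ (Finset.mem_univ i),
    ← Finset.add_sum_erase (a := i) Finset.univ
      (fun k => (X.updateRow i 0)ᵀ a k * X.updateRow i 0 k b) (Finset.mem_univ i)]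
  have h : ∀ k ∈ Finset.univ.erase i, (X.updateRow i 0)ᵀ a k * X.updateRow i 0 k b =
      Xᵀ a k * X k b := fun k hk => by
    rw [Matrix.transpose_apply, Matrix.updateRow_ne (Finset.ne_of_mem_erase hk),
      Matrix.transpose_apply]
  rw [Finset.sum_congr rfl h]
  simp [Matrix.vecMulVec_apply, add_comm]

/-- Changing one row of `M` and deleting another costs at most two row norms in the Gram form. -/
theorem gram_updateRow_zero_ge {ι κ : Type*} [Fintype ι] [DecidableEq ι] [Fintype κ]
    {M X : Matrix ι κ ℝ} (hMX : Neighboring M X) {ρ : ℝ} (hρ : ∀ k, M k ⬝ᵥ M k ≤ ρ) (i : ι)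
    (z : κ → ℝ) :
    (M *ᵥ z) ⬝ᵥ (M *ᵥ z) - 2 * ρ * (z ⬝ᵥ z) ≤
      z ⬝ᵥ ((X.updateRow i 0)ᵀ * X.updateRow i 0) *ᵥ z := by
  obtain ⟨j, hj⟩ := hMX
  have hzz : 0 ≤ z ⬝ᵥ z := dotProduct_self_nonneg _
  have hq : z ⬝ᵥ ((X.updateRow i 0)ᵀ * X.updateRow i 0) *ᵥ z =
      ∑ k, (X.updateRow i 0 k ⬝ᵥ z) ^ 2 := by
    rw [← Matrix.mulVec_mulVec, Matrix.dotProduct_mulVec, Matrix.vecMul_transpose, dotProduct]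
    exact Finset.sum_congr rfl fun i _ => (sq _).symm
  have hMq : (M *ᵥ z) ⬝ᵥ (M *ᵥ z) = ∑ k, (M k ⬝ᵥ z) ^ 2 :=
    Finset.sum_congr rfl fun i _ => (sq _).symm
  have hrow : ∀ k, (M k ⬝ᵥ z) ^ 2 ≤ ρ * (z ⬝ᵥ z) := fun k =>
    (sq_dotProduct_le _ _).trans (mul_le_mul_of_nonneg_right (hρ k) hzz)
  have hρz : 0 ≤ ρ * (z ⬝ᵥ z) := (sq_nonneg _).trans (hrow i)
  have hterm : ∀ k, (M k ⬝ᵥ z) ^ 2 ≤ (X.updateRow i 0 k ⬝ᵥ z) ^ 2 +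
      ((if k = i then ρ * (z ⬝ᵥ z) else 0) + if k = j then ρ * (z ⬝ᵥ z) else 0) := fun k => by
    have h0 := sq_nonneg (X.updateRow i 0 k ⬝ᵥ z)
    have h1 := hrow k
    by_cases hki : k = i
    · rw [if_pos hki]
      split_ifs <;> linarith
    · by_cases hkj : k = j
      · rw [if_neg hki, if_pos hkj]
        linarith
      · have hXM : X.updateRow i 0 k = M k := by
          rw [hj k hkj]
          exact Matrix.updateRow_ne hki
        rw [if_neg hki, if_neg hkj, hXM]
        linarith
  have hsum := Finset.sum_le_sum fun k (_ : k ∈ Finset.univ) => hterm k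
  rw [Finset.sum_add_distrib, Finset.sum_add_distrib, Finset.sum_ite_eq', Finset.sum_ite_eq',
    if_pos (Finset.mem_univ _), if_pos (Finset.mem_univ _)] at hsum
  rw [hMq, hq]
  linarith

/-- Here `τ` is a lower bound on the Gram form of `M`, and `ρ` bounds the squared row norms of every
admissible input. -/
theorem likelihoodMomentLE_sketchRowLaw_of_neighboring {ι κ : Type*} [Fintype ι] [Fintype κ]
    [DecidableEq κ] {M X Y : Matrix ι κ ℝ} {v : ℝ≥0} {s τ ρ : ℝ} (hv : v ≠ 0) (hs : 0 ≤ s)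
    (hτ : ∀ z, τ * (z ⬝ᵥ z) ≤ (M *ᵥ z) ⬝ᵥ (M *ᵥ z))
    (hρ : ρ = Fintype.card κ * maxAbsEntry M ^ 2) (hlam : 0 < τ - 2 * ρ)
    (hr : ρ / (τ - 2 * ρ) ≤ 1) (hsr : s * (ρ / (τ - 2 * ρ)) ≤ 3 / 4)
    (hX : X ∈ inputsAround M) (hY : Y ∈ inputsAround M) (hXY : Neighboring X Y) :
    LikelihoodMomentLE s (2 * (ρ / (τ - 2 * ρ)) ^ 2 * (s + 2 * s ^ 2))
      (sketchRowLaw v X) (sketchRowLaw v Y) := by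
  classical
  obtain ⟨i, hi⟩ := hXY
  set G := (X.updateRow i 0)ᵀ * X.updateRow i 0 with hG
  have hZ : Y.updateRow i 0 = X.updateRow i 0 := by
    ext k l
    by_cases hk : k = i
    · subst hk; simp
    · rw [Matrix.updateRow_ne hk, Matrix.updateRow_ne hk, hi k hk]
  have hGX : Xᵀ * X = G + Matrix.vecMulVec (X i) (X i) := gram_eq_updateRow_add X i
  have hGY : Yᵀ * Y = G + Matrix.vecMulVec (Y i) (Y i) := by
    rw [hG, ← hZ]; exact gram_eq_updateRow_add Y i
  have hGsymm : G.IsSymm := by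
    rw [Matrix.IsSymm, hG, Matrix.transpose_mul, Matrix.transpose_transpose]
  have hGlam : ∀ z, (τ - 2 * ρ) * (z ⬝ᵥ z) ≤ z ⬝ᵥ G *ᵥ z := fun z => by
    have := gram_updateRow_zero_ge hX.1 (fun k => hρ ▸ dotProduct_row_self_le le_rfl k) i z
    linarith [hτ z]
  have hρr : Fintype.card κ * maxAbsEntry M ^ 2 ≤ ρ / (τ - 2 * ρ) * (τ - 2 * ρ) := by
    rw [div_mul_cancel₀ _ hlam.ne', hρ]
  obtain ⟨W, V, D, hWV, hVW, hQ, hP, hD, hDr, hsum⟩ :=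
    exists_diagonalization_of_rank_one_perturbations hGsymm hlam hr hGlam
      ((dotProduct_row_self_le hX.2 i).trans hρr) ((dotProduct_row_self_le hY.2 i).trans hρr)
  refine (likelihoodMomentLE_sketchRowLaw hv hs hWV hVW (hGY.trans hQ) (hGX.trans hP) hD
    fun j => (mul_le_mul_of_nonneg_left (hDr j) hs).trans hsr).mono ?_
  rw [← Finset.sum_mul]
  exact mul_le_mul_of_nonneg_right hsum (by positivity)

/-! ### Published sketches -/

theorem publishOne_eq_pi {n : ℕ} {κ : Type*} (m : ℕ) (v : ℝ≥0) (X : Matrix (Fin n) κ ℝ) :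
    publishOne m v X = Measure.pi fun _ : Fin m => sketchRowLaw v X := by
  have : ∀ _ : Fin m, SigmaFinite
      ((Measure.pi fun _ : Fin n => gaussianReal 0 v).map fun g => g ᵥ* X) :=
    fun _ => inferInstanceAs (SigmaFinite (sketchRowLaw v X))
  exact Measure.pi_map_pi (μ := fun _ : Fin m => Measure.pi fun _ : Fin n => gaussianReal 0 v)
    (f := fun _ g => g ᵥ* X) fun _ => (measurable_vecMul X).aemeasurable

instance isProbabilityMeasure_gaussianSketch (m n : ℕ) (v : ℝ≥0) :
    IsProbabilityMeasure (gaussianSketch m n v) :=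
  inferInstanceAs (IsProbabilityMeasure
    (Measure.pi fun _ : Fin m => Measure.pi fun _ : Fin n => gaussianReal 0 v))

instance isProbabilityMeasure_publishOne {n : ℕ} {κ : Type*} (m : ℕ) (v : ℝ≥0)
    (X : Matrix (Fin n) κ ℝ) : IsProbabilityMeasure (publishOne m v X) := by
  rw [publishOne_eq_pi]
  exact inferInstanceAs (IsProbabilityMeasure (Measure.pi fun _ : Fin m => sketchRowLaw v X))

theorem measurable_matrix_mul_right {m n : ℕ} {κ : Type*} (X : Matrix (Fin n) κ ℝ) :
    Measurable fun S : Matrix (Fin m) (Fin n) ℝ => S * X :=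
  measurable_pi_lambda _ fun i => (measurable_vecMul X).comp (measurable_pi_apply i)

theorem publishAll_eq_pi {n : ℕ} {κ : Type*} (q m : ℕ) (v : ℝ≥0) (X : Matrix (Fin n) κ ℝ) :
    publishAll q m v X = Measure.pi fun _ : Fin q => publishOne m v X := by
  have : ∀ _ : Fin q, SigmaFinite ((gaussianSketch m n v).map fun S => S * X) :=
    fun _ => inferInstanceAs (SigmaFinite (publishOne m v X))
  exact Measure.pi_map_pi (μ := fun _ : Fin q => gaussianSketch m n v)
    (f := fun _ S => S * X) fun _ => (measurable_matrix_mul_right X).aemeasurable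

theorem LikelihoodMomentLE.publishOne {n : ℕ} {κ : Type*} {s K : ℝ} {v : ℝ≥0}
    {X Y : Matrix (Fin n) κ ℝ} (hs : 0 ≤ s)
    (h : LikelihoodMomentLE s K (sketchRowLaw v X) (sketchRowLaw v Y)) (m : ℕ) :
    LikelihoodMomentLE s (m * K) (publishOne m v X) (publishOne m v Y) := by
  have := LikelihoodMomentLE.pi hs fun _ : Fin m => h
  rw [Finset.sum_const, Finset.card_univ, Fintype.card_fin, nsmul_eq_mul] at this
  rw [publishOne_eq_pi, publishOne_eq_pi]
  exact this

theorem LikelihoodMomentLE.publishAll {n : ℕ} {κ : Type*} {s K : ℝ} {v : ℝ≥0}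
    {X Y : Matrix (Fin n) κ ℝ} (hs : 0 ≤ s)
    (h : LikelihoodMomentLE s K (sketchRowLaw v X) (sketchRowLaw v Y)) (q m : ℕ) :
    LikelihoodMomentLE s ((q * m : ℝ) * K) (publishAll q m v X) (publishAll q m v Y) := by
  have := LikelihoodMomentLE.pi hs fun _ : Fin q => h.publishOne hs m
  rw [Finset.sum_const, Finset.card_univ, Fintype.card_fin, nsmul_eq_mul, ← mul_assoc] at this
  rw [publishAll_eq_pi, publishAll_eq_pi]
  exact this

/-! ### The order of the moment and the privacy guarantee -/

/-- The order `s = 3 β / (2 ε)` makes Markov's inequality gain `s ε = 3 β / 2`, while `N` sketched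
rows cost at most `β / 2`. -/
theorem total_moment_le {ε β ρ τ N : ℝ} (hε : 0 < ε) (hβ : 0 < β) (hρ : 0 < ρ)
    (hτ : (3 + 2 * β / ε) * ρ ≤ τ)
    (hN : N ≤ 1 / 162 * (τ / ρ) ^ 2 * (β * (ε ^ 2 / (ε + β) ^ 2))) :
    0 < τ - 2 * ρ ∧ ρ / (τ - 2 * ρ) ≤ 1 ∧ 3 * β / (2 * ε) * (ρ / (τ - 2 * ρ)) ≤ 3 / 4 ∧
      N * (2 * (ρ / (τ - 2 * ρ)) ^ 2 * (3 * β / (2 * ε) + 2 * (3 * β / (2 * ε)) ^ 2)) -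
        3 * β / (2 * ε) * ε ≤ -β := by
  have hβε : 0 < β / ε := div_pos hβ hε
  have hlow : ρ + 2 * (β / ε) * ρ ≤ τ - 2 * ρ := by
    have : (3 + 2 * β / ε) * ρ = 3 * ρ + 2 * (β / ε) * ρ := by ring
    linarith
  have hpos : 0 < 2 * (β / ε) * ρ := by positivity
  have hlam : 0 < τ - 2 * ρ := by linarith
  have hτ0 : 0 < τ := by linarith
  refine ⟨hlam, (div_le_one hlam).2 (by linarith), ?_, ?_⟩
  · rw [show 3 * β / (2 * ε) * (ρ / (τ - 2 * ρ)) = (3 / 2 * (β / ε) * ρ) / (τ - 2 * ρ) by ring,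
      div_le_iff₀ hlam]
    linarith
  · have hr3 : ρ / (τ - 2 * ρ) ≤ 3 * (ρ / τ) := by
      rw [← mul_div_assoc, div_le_div_iff₀ hlam hτ0]
      nlinarith
    have hr0 : 0 ≤ ρ / (τ - 2 * ρ) := by positivity
    have hsq : (ρ / (τ - 2 * ρ)) ^ 2 ≤ 9 * (ρ / τ) ^ 2 := by nlinarith
    set s := 3 * β / (2 * ε) with hs
    have hs0 : 0 < s := by positivity
    have hsε : s * ε = 3 / 2 * β := by rw [hs]; field_simp
    have hss : s + 2 * s ^ 2 ≤ 9 / 2 * (β * (ε + β) / ε ^ 2) := by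
      have : 9 / 2 * (β * (ε + β) / ε ^ 2) - (s + 2 * s ^ 2) = 3 * (β / ε) := by
        rw [hs]; field_simp; ring
      linarith
    have hcost : N * (2 * (ρ / (τ - 2 * ρ)) ^ 2 * (s + 2 * s ^ 2)) ≤ β / 2 := by
      calc N * (2 * (ρ / (τ - 2 * ρ)) ^ 2 * (s + 2 * s ^ 2))
          ≤ (1 / 162 * (τ / ρ) ^ 2 * (β * (ε ^ 2 / (ε + β) ^ 2))) *
            (2 * (9 * (ρ / τ) ^ 2) * (9 / 2 * (β * (ε + β) / ε ^ 2))) := by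
            gcongr
        _ = β / 2 * (β / (ε + β)) := by
            field_simp
            norm_num
        _ ≤ β / 2 * 1 := by
            gcongr
            exact (div_le_one (by positivity)).2 (by linarith)
        _ = β / 2 := mul_one _
    linarith

theorem mainTheorem12 :
    ∃ c : ℝ, 0 < c ∧
      ∀ (n d q : ℕ) (A : Matrix (Fin n) (Fin d) ℝ) (b : Fin n → ℝ) (ε δ β σ₀ B₀ : ℝ) (v : ℝ≥0),
        0 < q → v ≠ 0 → 0 < ε → 0 < δ →
        β = Real.log (4 / δ) → 1 + Real.log 4 < β →
        (concatData A b).rank = d + 1 →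
        σ₀ = sigmaMin (concatData A b) / Real.sqrt n →
        B₀ = maxAbsEntry (concatData A b) →
        (n : ℝ) / (d + 1) ≥ (3 + 2 * β / ε) * (B₀ ^ 2 / σ₀ ^ 2) →
        (∀ m : ℕ, d + 1 < m →
          (m : ℝ) ≤ c * (σ₀ / B₀) ^ 4 *
            (β * ((n : ℝ) ^ 2 / ((d : ℝ) + 1) ^ 2) * (ε ^ 2 / (ε + β) ^ 2)) →
          IsDifferentiallyPrivateOn (publishOne m v) (inputsAround (concatData A b)) ε δ) ∧
        (∀ m : ℕ, d + 1 < m →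
          (m : ℝ) ≤ c * (σ₀ / B₀) ^ 4 *
            (β / q * ((n : ℝ) ^ 2 / ((d : ℝ) + 1) ^ 2) * (ε ^ 2 / (ε + β) ^ 2)) →
          IsDifferentiallyPrivateOn (publishAll q m v) (inputsAround (concatData A b)) ε δ) := by
  refine ⟨1 / 162, by norm_num, ?_⟩
  intro n d q A b ε δ β σ₀ B₀ v hq hv hε hδ hβ hβ1 hrank hσ hB hn
  set M := concatData A b with hM
  have hβ0 : 0 < β := by linarith [Real.log_pos (by norm_num : (1 : ℝ) < 4)]
  have hexpβ : Real.exp (-β) ≤ δ := by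
    rw [hβ, ← Real.log_inv, Real.exp_log (by positivity), inv_div]
    linarith
  have hcard : Fintype.card (Fin d ⊕ Unit) = d + 1 := by simp
  have hcard' : ((Fintype.card (Fin d ⊕ Unit) : ℕ) : ℝ) = (d : ℝ) + 1 := by rw [hcard]; simp
  set s := 3 * β / (2 * ε) with hs
  have hs0 : 0 < s := by positivity
  -- Both claims concern `N` independent sketched rows: `N = m`, respectively `N = q * m`.
  have hrow : ∀ N : ℝ, 0 < N → N ≤ 1 / 162 * (σ₀ / B₀) ^ 4 *
      (β * ((n : ℝ) ^ 2 / ((d : ℝ) + 1) ^ 2) * (ε ^ 2 / (ε + β) ^ 2)) →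
      ∃ K : ℝ, N * K - s * ε ≤ -β ∧ ∀ X ∈ inputsAround M, ∀ Y ∈ inputsAround M,
        Neighboring X Y → LikelihoodMomentLE s K (sketchRowLaw v X) (sketchRowLaw v Y) := by
    intro N hN hNle
    -- A positive number of rows forces `n`, `σ₀` and `B₀` to be nonzero.
    have hpos := hN.trans_le hNle
    have hσ0 : σ₀ ≠ 0 := by rintro h; simp [h] at hpos
    have hB0 : B₀ ≠ 0 := by rintro h; simp [h] at hpos
    have hn0 : (n : ℝ) ≠ 0 := by rintro h; simp [h] at hpos
    have hnpos : (0 : ℝ) < n := lt_of_le_of_ne n.cast_nonneg hn0.symm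
    have hd : (0 : ℝ) < (d : ℝ) + 1 := by positivity
    have hτeq : sigmaMin M ^ 2 = n * σ₀ ^ 2 := by
      rw [hσ, div_pow, Real.sq_sqrt hnpos.le]
      field_simp
    have hρpos : 0 < ((d : ℝ) + 1) * B₀ ^ 2 := by positivity
    have hτρ : (3 + 2 * β / ε) * (((d : ℝ) + 1) * B₀ ^ 2) ≤ n * σ₀ ^ 2 := by
      have h := (le_div_iff₀ hd).1 hn
      have hσsq : 0 < σ₀ ^ 2 := by positivity
      have h2 := mul_le_mul_of_nonneg_right h hσsq.le
      refine le_trans (le_of_eq ?_) h2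
      field_simp
    obtain ⟨h1, h2, h3, h4⟩ := total_moment_le (N := N) hε hβ0 hρpos hτρ (hNle.trans_eq (by
      field_simp))
    refine ⟨_, h4, fun X hX Y hY hXY => ?_⟩
    refine likelihoodMomentLE_sketchRowLaw_of_neighboring hv hs0.le (fun z => ?_) ?_ h1 h2 h3
      hX hY hXY
    · rw [← hτeq]
      exact sq_sigmaMin_mul_le (hrank.trans hcard.symm) z
    · rw [hcard', hB]
  have hδle : ∀ N K : ℝ, N * K - s * ε ≤ -β →
      ENNReal.ofReal (Real.exp (N * K - s * ε)) ≤ ENNReal.ofReal δ := fun N K h =>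
    ENNReal.ofReal_le_ofReal ((Real.exp_le_exp.2 h).trans hexpβ)
  refine ⟨fun m hm hmle X hX Y hY hXY T hT => ?_, fun m hm hmle X hX Y hY hXY T hT => ?_⟩
  · have hm0 : (0 : ℝ) < m := by exact_mod_cast (Nat.zero_lt_succ d).trans hm
    obtain ⟨K, hK, h⟩ := hrow m hm0 hmle
    exact (((h X hX Y hY hXY).publishOne hs0.le m).measure_le hs0 hT).trans
      (add_le_add le_rfl (hδle _ _ hK))
  · have hm0 : (0 : ℝ) < m := by exact_mod_cast (Nat.zero_lt_succ d).trans hm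
    have hq0 : (0 : ℝ) < q := by exact_mod_cast hq
    obtain ⟨K, hK, h⟩ := hrow (q * m) (by positivity)
      ((mul_le_mul_of_nonneg_left hmle hq0.le).trans_eq (by field_simp))
    exact (((h X hX Y hY hXY).publishAll hs0.le q m).measure_le hs0 hT).trans
      (add_le_add le_rfl (hδle _ _ hK))
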